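/- Let $n\ge 2$ and let $\mathcal H^n=\{x\in\mathbb R^{n+1}\mid \langle x,x\rangle=-1,\ x_{n+1}>0\}$ be hyperbolic space in the hyperboloid model, where $\langle x,y\rangle=\sum_{i=1}^n x_iy_i-x_{n+1}y_{n+1}$; its isometry group is the group $\mathrm O^+(n,1)$ of the real matrices that preserve $\langle\cdot,\cdot\rangle$ and have positive last diagonal entry. Let $P=\bigcap_{i=1}^N\{x\in\mathcal H^n\mid\langle x,e_i\rangle\le 0\}$, with $\langle e_i,e_i\rangle=1$, be a Coxeter polyhedron: $P$ has non-empty interior, and any two of the bounding hyperplanes $e_i^\perp$, $e_j^\perp$ ($i\ne j$) either meet under an angle $\pi/m$ of $P$ with an integer $m\ge 2$ (that is, $\langle e_i,e_j\rangle=-\cos(\pi/m)$) or are parallel or ultraparallel (that is, $\langle e_i,e_j\rangle\le -1$). Let $\Gamma$ be the group generated by the reflections $s_i(x)=x-2\langle x,e_i\rangle e_i$, $1\le i\le N$. Assume that $\Gamma$ is * cofinite: $P$ has finite hyperbolic volume; and * quasi-arithmetic: there are a totally real number field $F\subset\mathbb R$, a quadratic form $q$ in $n+1$ variables over $F$ which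 has signature $(n,1)$ over $\mathbb R$ and for which $q^\sigma$ is positive definite for every embedding $\sigma:F\to\mathbb R$ other than the inclusion, and a real invertible matrix $S$ with $S^{-1}\mathrm O^+(n,1)S=\mathrm O^+(q)$ and $S^{-1}\Gamma S\subset \mathrm O^+(q)\cap \mathrm{GL}(n+1,F)$. Here $\mathrm O^+(q)$ is the group of the real matrices that preserve $q$ and each of the two components of $\{q<0\}$. Let $G=(g_{ij})$, $g_{ij}=\langle e_i,e_j\rangle$, be the Gram matrix, and let $K\subset\mathbb R$ be the Vinberg field of $\Gamma$, generated over $\mathbb Q$ by all the cycles $2^l g_{i_1i_2}g_{i_2i_3}\cdots g_{i_{l-1}i_l}g_{i_li_1}$ of $2G$. Let $C=s_{\pi(1)}s_{\pi(2)}\cdots s_{\pi(N)}\in\Gamma$, with any permutation $\pi$ of $\{1,\dots,N\}$, be a Coxeter transformation of $\Gamma$, and let $\chi_C(t)=a_0+a_1t+\dots+a_{n+1}t^{n+1}$ be its characteristic polynomial as an $(n+1)\times(n+1)$ matrix. Then $$K=\mathbb Q(a_0,a_1,\dots,a_{n+1}),$$ as subfields of $\mathbb R$. -/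

import Mathlib

open scoped ENNReal

noncomputable section

/-! ## The hyperboloid model -/

/-- The Lorentzian product `x₁ y₁ + ⋯ + xₙ yₙ - xₙ₊₁ yₙ₊₁` on `ℝⁿ⁺¹`. -/
def lorentz {n : ℕ} (x y : Fin (n + 1) → ℝ) : ℝ :=
  (∑ i : Fin n, x i.castSucc * y i.castSucc) - x (Fin.last n) * y (Fin.last n)

/-- The matrix `J = diag(1, …, 1, -1)` of the Lorentzian product. -/
def lorentzMatrix (n : ℕ) : Matrix (Fin (n + 1)) (Fin (n + 1)) ℝ :=
  Matrix.diagonal fun i => if i = Fin.last n then -1 else 1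

/-- Hyperbolic space `ℋⁿ`, the upper sheet of the hyperboloid. -/
def hyperbolicSpace (n : ℕ) : Set (Fin (n + 1) → ℝ) :=
  {x | lorentz x x = -1 ∧ 0 < x (Fin.last n)}

/-- The global chart `ℝⁿ → ℋⁿ`, `x ↦ (x, √(1 + |x|²))`. -/
def hyperboloidPoint {n : ℕ} (x : Fin n → ℝ) : Fin (n + 1) → ℝ :=
  Fin.snoc (α := fun _ => ℝ) x (Real.sqrt (1 + ∑ i, x i ^ 2))

/-- Hyperbolic volume of a subset of `ℋⁿ`: in the chart `hyperboloidPoint` the Riemannian volume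
element of `ℋⁿ` is `dx / √(1 + |x|²)`. -/
def hyperbolicVolume {n : ℕ} (A : Set (Fin (n + 1) → ℝ)) : ℝ≥0∞ :=
  ∫⁻ x in {x : Fin n → ℝ | hyperboloidPoint x ∈ A},
    ENNReal.ofReal (1 / Real.sqrt (1 + ∑ i, x i ^ 2))

/-- The group `O⁺(n,1) = Isom(ℋⁿ)` of positive Lorentzian matrices. -/
def lorentzGroupPlus (n : ℕ) : Set (GL (Fin (n + 1)) ℝ) :=
  {A | A.val.transpose * lorentzMatrix n * A.val = lorentzMatrix n ∧
    0 < A.val (Fin.last n) (Fin.last n)}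

/-! ## Coxeter polyhedra and their reflection groups -/

/-- The matrix of `s_e : x ↦ x - 2 ⟨x, e⟩ e`. -/
def reflectionMatrix {n : ℕ} (e : Fin (n + 1) → ℝ) : Matrix (Fin (n + 1)) (Fin (n + 1)) ℝ :=
  1 - (2 : ℝ) • Matrix.vecMulVec e (Matrix.mulVec (lorentzMatrix n) e)

theorem lorentz_eq_dotProduct {n : ℕ} (x y : Fin (n + 1) → ℝ) :
    lorentz x y = dotProduct (Matrix.mulVec (lorentzMatrix n) x) y := by
  simp [lorentz, lorentzMatrix, dotProduct, Matrix.mulVec_diagonal, Fin.sum_univ_castSucc,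
    Fin.castSucc_ne_last, sub_eq_add_neg]

theorem reflectionMatrix_mulVec {n : ℕ} (e x : Fin (n + 1) → ℝ) :
    Matrix.mulVec (reflectionMatrix e) x = x - (2 * lorentz x e) • e := by
  have h : dotProduct (Matrix.mulVec (lorentzMatrix n) e) x = lorentz x e := by
    rw [← lorentz_eq_dotProduct]; simp [lorentz, mul_comm]
  rw [reflectionMatrix, Matrix.sub_mulVec, Matrix.one_mulVec, Matrix.smul_mulVec,
    Matrix.vecMulVec_mulVec, h]
  ext i
  simp
  ring

theorem reflectionMatrix_mul_self {n : ℕ} {e : Fin (n + 1) → ℝ} (he : lorentz e e = 1) :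
    reflectionMatrix e * reflectionMatrix e = 1 := by
  have h := he
  rw [lorentz_eq_dotProduct] at h
  simp only [reflectionMatrix, sub_mul, mul_sub, one_mul, mul_one, smul_mul_assoc, mul_smul_comm,
    Matrix.vecMulVec_mul_vecMulVec, h, one_smul]
  module

/-- A Coxeter polyhedron `P = ⋂ᵢ {x ∈ ℋⁿ | ⟨x, eᵢ⟩ ≤ 0}` given by its outer unit normal vectors
`e₁, …, e_N`.

* `interior_nonempty`: the interior of `P` in `ℋⁿ` is the set of the points that satisfy all the
  strict inequalities.
* `angles`: if `|⟨eᵢ, eⱼ⟩| < 1`, the hyperplanes of `eᵢ` and `eⱼ` intersect and `P` has the angle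
  `α` with `⟨eᵢ, eⱼ⟩ = - cos α` there; this has to be `π / m` with `m ≥ 2`. If `⟨eᵢ, eⱼ⟩ = -1` the
  hyperplanes are parallel (angle zero), and if `⟨eᵢ, eⱼ⟩ < -1` they are ultraparallel. If
  `⟨eᵢ, eⱼ⟩ ≥ 1`, then one of the two half-spaces contains the other, so that one of the two
  hyperplanes does not bound `P`. Conversely, the conditions below imply that each of
  the `N` half-spaces is needed in the intersection: if `x` is an interior point, then
  `x + t eᵢ` leaves the `i`-th half-space first (and does so while it is still timelike). -/
structure CoxeterPolyhedron (n N : ℕ) where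
  /-- The outer normal vectors. -/
  normal : Fin N → Fin (n + 1) → ℝ
  unit : ∀ i, lorentz (normal i) (normal i) = 1
  interior_nonempty : ∃ x ∈ hyperbolicSpace n, ∀ i, lorentz x (normal i) < 0
  angles : ∀ i j, i ≠ j →
    (∃ m : ℕ, 2 ≤ m ∧ lorentz (normal i) (normal j) = -Real.cos (Real.pi / m)) ∨
      lorentz (normal i) (normal j) ≤ -1

namespace CoxeterPolyhedron

variable {n N : ℕ} (P : CoxeterPolyhedron n N)

/-- The underlying subset of `ℋⁿ`. -/
def carrier : Set (Fin (n + 1) → ℝ) :=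
  {x | x ∈ hyperbolicSpace n ∧ ∀ i, lorentz x (P.normal i) ≤ 0}

/-- The reflection in the `i`-th bounding hyperplane. -/
def reflection (i : Fin N) : GL (Fin (n + 1)) ℝ where
  val := reflectionMatrix (P.normal i)
  inv := reflectionMatrix (P.normal i)
  val_inv := reflectionMatrix_mul_self (P.unit i)
  inv_val := reflectionMatrix_mul_self (P.unit i)

/-- The hyperbolic Coxeter group of `P`, generated by the reflections in the hyperplanes
that bound `P`. -/
def coxeterGroup : Subgroup (GL (Fin (n + 1)) ℝ) :=
  Subgroup.closure (Set.range P.reflection)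

/-- The Coxeter group is cofinite: `P` has finite hyperbolic volume. -/
def IsCofinite : Prop := hyperbolicVolume P.carrier < ⊤

/-- The Gram matrix. -/
def gram : Matrix (Fin N) (Fin N) ℝ :=
  Matrix.of fun i j => lorentz (P.normal i) (P.normal j)

/-- The cycle `2ˡ g_{i₁ i₂} g_{i₂ i₃} ⋯ g_{i_l i₁}` of twice the Gram matrix, of length `l + 1`
in the present indexing; `k + 1` is taken cyclically in `Fin (l + 1)`. -/
def cycle {l : ℕ} (i : Fin (l + 1) → Fin N) : ℝ :=
  ∏ k, 2 * P.gram (i k) (i (k + 1))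

/-- The Vinberg field: the subfield of `ℝ` generated by all cycles of twice the Gram matrix. -/
def vinbergField : IntermediateField ℚ ℝ :=
  IntermediateField.adjoin ℚ {b | ∃ (l : ℕ) (i : Fin (l + 1) → Fin N), b = P.cycle i}

/-- The Coxeter transformation `s_{π(1)} s_{π(2)} ⋯ s_{π(N)}`: the product of all the generating
reflections, each taken once, in the order prescribed by the permutation `π`. -/
def coxeterTransformation (π : Equiv.Perm (Fin N)) : GL (Fin (n + 1)) ℝ :=
  (List.ofFn fun k => P.reflection (π k)).prod

end CoxeterPolyhedron

/-- The Coxeter field: the subfield of `ℝ` generated by the coefficients of the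
characteristic polynomial of `C`. -/
def coxeterField {n : ℕ} (C : GL (Fin (n + 1)) ℝ) : IntermediateField ℚ ℝ :=
  IntermediateField.adjoin ℚ (Set.range fun j : ℕ => (Matrix.charpoly C.val).coeff j)

/-! ## Quasi-arithmetic groups -/

/-- A real symmetric matrix has signature `(n,1)`: it is congruent to `diag(1, …, 1, -1)`. -/
def HasLorentzSignature {n : ℕ} (Q : Matrix (Fin (n + 1)) (Fin (n + 1)) ℝ) : Prop :=
  ∃ T : GL (Fin (n + 1)) ℝ, T.val.transpose * lorentzMatrix n * T.val = Q

/-- The group `O⁺(q)` of a real quadratic form `q(x) = xᵀ Q x` of signature `(n,1)`: the invertible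
matrices that preserve `q` and map each of the two components of the cone `{q < 0}` to itself
(two vectors of this cone lie in the same component if and only if their product is negative). -/
def orthogonalGroupPlus {n : ℕ} (Q : Matrix (Fin (n + 1)) (Fin (n + 1)) ℝ) :
    Set (GL (Fin (n + 1)) ℝ) :=
  {U | U.val.transpose * Q * U.val = Q ∧
    ∀ x : Fin (n + 1) → ℝ, dotProduct x (Matrix.mulVec Q x) < 0 →
      dotProduct x (Matrix.mulVec Q (Matrix.mulVec U.val x)) < 0}

/-- A subgroup `Γ` of `O⁺(n,1)` is quasi-arithmetic: there are a totally real number field `K ⊂ ℝ`,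
a quadratic form `q` over `K` (with symmetric matrix `Q`) of signature `(n,1)` such that `q^σ` is
positive definite for every embedding `σ : K → ℝ` other than the inclusion, and a real invertible
`S` with `S⁻¹ O⁺(n,1) S = O⁺(q)` and `S⁻¹ Γ S ⊆ O⁺(q) ∩ GL(n+1, K)`. The notion is used for
discrete groups; the group of a Coxeter polyhedron is always discrete. -/
def IsQuasiArithmetic {n : ℕ} (Γ : Subgroup (GL (Fin (n + 1)) ℝ)) : Prop :=
  ∃ (K : IntermediateField ℚ ℝ) (Q : Matrix (Fin (n + 1)) (Fin (n + 1)) K)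
    (S : GL (Fin (n + 1)) ℝ),
    NumberField K ∧ NumberField.IsTotallyReal K ∧
    Q.IsSymm ∧
    HasLorentzSignature (Q.map (algebraMap K ℝ)) ∧
    (∀ σ : K →+* ℝ, σ ≠ algebraMap K ℝ → (Q.map σ).PosDef) ∧
    (∀ A : GL (Fin (n + 1)) ℝ,
      A ∈ lorentzGroupPlus n ↔ S⁻¹ * A * S ∈ orthogonalGroupPlus (Q.map (algebraMap K ℝ))) ∧
    ∀ γ ∈ Γ, S⁻¹ * γ * S ∈ orthogonalGroupPlus (Q.map (algebraMap K ℝ)) ∩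
      Set.range (Matrix.GeneralLinearGroup.map (n := Fin (n + 1)) (algebraMap K ℝ))

end

/-! Write `L` for the Coxeter field and `F` for the field of definition in the quasi-arithmeticity
hypothesis. The inclusion `L ≤ K` holds for every Coxeter polyhedron, and quasi-arithmeticity yields
`K ≤ F ≤ L`.

Twice the Gram matrix is `U + Uᵀ` with `U` unitriangular in the order of the reflections, and up to
powers of `r - 1` the characteristic polynomial of `C` at `r` is `det (r U + Uᵀ)`
(`eval_charpoly_prod_reflectionMatrix`). For rational `r` the Leibniz expansion of this determinant
is a rational combination of products of cycles, and interpolation gives `L ≤ K`.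

Each cycle is the trace of a product of matrices `1 - sᵢ`, all of which are conjugated into matrices
over `F` by the same `S`; hence `K ≤ F`.

For `F ≤ L`, Galois theory reduces the claim to showing that an embedding `σ` of `F` fixing `F ∩ L`
is the inclusion. Otherwise `q^σ` is positive definite, so the image under `σ` of the matrix of `C`
over `F` has no eigenvalue greater than 1. But `σ` fixes the characteristic polynomial of `C`, and
`C` does have such an eigenvalue: if `r U + Uᵀ` were nonsingular for all `r > 1`, a deformation
through M-matrices would make the Gram matrix positive semidefinite, whereas finite volume forces
the normals to span, so that the Gram form takes a negative value. -/

/-! ## M-matrices -/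

section MMatrix

open Matrix Topology

variable {ι : Type*} [Fintype ι]

/-- A nonsingular M-matrix: the off-diagonal entries are nonpositive, and some positive vector
has a positive image. -/
structure IsMMatrix (A : Matrix ι ι ℝ) : Prop where
  offDiag_nonpos : ∀ i j, i ≠ j → A i j ≤ 0
  exists_pos : ∃ x : ι → ℝ, (∀ i, 0 < x i) ∧ ∀ i, 0 < (A *ᵥ x) i

namespace IsMMatrix

/-- A minimum principle. At an index `k` minimizing `y k / x k`, a negative minimum `-t` makes `y +
t x` nonnegative and zero at `k`; the signs of row `k` then contradict `(A x) k > 0`. -/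
theorem nonneg_of_mulVec_nonneg {A : Matrix ι ι ℝ} (hA : IsMMatrix A) {y : ι → ℝ}
    (hy : ∀ i, 0 ≤ (A *ᵥ y) i) (i : ι) : 0 ≤ y i := by
  obtain ⟨x, hx, hAx⟩ := hA.exists_pos
  have : Nonempty ι := ⟨i⟩
  obtain ⟨k, hk⟩ := Finite.exists_min fun i => y i / x i
  by_contra! hi
  have hneg : y k / x k < 0 := (hk i).trans_lt (div_neg_of_neg_of_pos hi (hx i))
  set t := -(y k / x k) with ht
  have hz : ∀ j, 0 ≤ (y + t • x) j := fun j => by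
    have := (le_div_iff₀ (hx j)).1 (hk j)
    simp only [Pi.add_apply, Pi.smul_apply, smul_eq_mul, ht]
    linarith
  have hzk : (y + t • x) k = 0 := by
    simp [ht, div_mul_cancel₀ _ (hx k).ne']
  have h1 : (A *ᵥ (y + t • x)) k ≤ 0 := by
    refine Finset.sum_nonpos fun j _ => ?_
    rcases eq_or_ne k j with rfl | hj
    · rw [hzk, mul_zero]
    · exact mul_nonpos_of_nonpos_of_nonneg (hA.offDiag_nonpos k j hj) (hz j)
  rw [mulVec_add, mulVec_smul] at h1
  simp only [Pi.add_apply, Pi.smul_apply, smul_eq_mul] at h1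
  have := mul_pos (by linarith : 0 < t) (hAx k)
  linarith [hy k]

theorem add_smul_one [DecidableEq ι] {A : Matrix ι ι ℝ} (hA : IsMMatrix A) {μ : ℝ} (hμ : 0 ≤ μ) :
    IsMMatrix (A + μ • (1 : Matrix ι ι ℝ)) := by
  obtain ⟨x, hx, hAx⟩ := hA.exists_pos
  refine ⟨fun i j hij => ?_, x, hx, fun i => ?_⟩
  · simpa [hij] using hA.offDiag_nonpos i j hij
  · have := mul_nonneg hμ (hx i).le
    simp only [add_mulVec, smul_mulVec, one_mulVec, Pi.add_apply, Pi.smul_apply, smul_eq_mul]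
    linarith [hAx i]

/-- For an M-matrix the solution of `B w = (det B)² • 1` is nonnegative. Writing `w` as `det B • adj
B • 1` avoids inverses, so the condition is closed and passes to the limit. A small multiple of the
all-ones vector then makes `w` strictly positive. -/
theorem of_mem_closure [DecidableEq ι] {A : Matrix ι ι ℝ}
    (hA : A ∈ closure {B : Matrix ι ι ℝ | IsMMatrix B}) (hdet : A.det ≠ 0) : IsMMatrix A := by
  have hcl : IsClosed {B : Matrix ι ι ℝ | (∀ i j, i ≠ j → B i j ≤ 0) ∧
      ∀ i, 0 ≤ ((B.det • B.adjugate) *ᵥ 1) i} := by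
    have h1 : IsClosed {B : Matrix ι ι ℝ | ∀ i j, i ≠ j → B i j ≤ 0} := by
      simp only [Set.ofPred_forall]
      exact isClosed_iInter fun i => isClosed_iInter fun j => isClosed_iInter fun _ =>
        isClosed_le (continuous_id.matrix_elem i j) continuous_const
    have h2 : IsClosed {B : Matrix ι ι ℝ | ∀ i, 0 ≤ ((B.det • B.adjugate) *ᵥ 1) i} := by
      simp only [Set.ofPred_forall]
      refine isClosed_iInter fun i => isClosed_le continuous_const ?_
      exact (continuous_apply i).comp
        ((continuous_id.matrix_det.smul continuous_id.matrix_adjugate).matrix_mulVec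
          continuous_const)
    exact h1.inter h2
  have key : ∀ B : Matrix ι ι ℝ, B *ᵥ ((B.det • B.adjugate) *ᵥ 1) = (B.det * B.det) • 1 := by
    intro B
    rw [mulVec_mulVec, mul_smul_comm, mul_adjugate, smul_smul, smul_mulVec, one_mulVec]
  obtain ⟨hoff, hw⟩ := closure_minimal (fun B (hB : IsMMatrix B) =>
    (⟨hB.offDiag_nonpos, hB.nonneg_of_mulVec_nonneg fun i => by
      rw [key]; simpa using mul_self_nonneg B.det⟩ : _ ∧ _)) hcl hA
  refine ⟨hoff, ?_⟩
  set w := (A.det • A.adjugate) *ᵥ 1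
  have hpos : 0 < A.det * A.det := mul_self_pos.2 hdet
  have hev : ∀ᶠ ε : ℝ in 𝓝[>] 0, ∀ i, 0 < A.det * A.det + ε * (A *ᵥ 1) i := by
    refine Filter.eventually_all.2 fun i => ?_
    have hc : Continuous fun ε : ℝ => A.det * A.det + ε * (A *ᵥ 1) i := by fun_prop
    exact nhdsWithin_le_nhds (hc.continuousAt.eventually (lt_mem_nhds (by simpa using hpos)))
  obtain ⟨ε, hε, hε0⟩ := (hev.and self_mem_nhdsWithin).exists
  refine ⟨w + ε • 1, fun i => ?_, fun i => ?_⟩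
  · simpa using add_pos_of_nonneg_of_pos (hw i) hε0
  · rw [mulVec_add, mulVec_smul, key]
    simpa using hε i

/-- Among nonsingular matrices with nonpositive off-diagonal entries, the M-matrices form an open
and closed set. -/
theorem of_path [DecidableEq ι] {X : Type*} [TopologicalSpace X] [PreconnectedSpace X]
    {f : X → Matrix ι ι ℝ} (hf : Continuous f) (hoff : ∀ t i j, i ≠ j → f t i j ≤ 0)
    (hdet : ∀ t, (f t).det ≠ 0) {t₀ : X} (h₀ : IsMMatrix (f t₀)) (t : X) : IsMMatrix (f t) := by
  have hclopen : IsClopen {t | IsMMatrix (f t)} := by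
    constructor
    · refine isClosed_of_closure_subset fun t ht => of_mem_closure ?_ (hdet t)
      exact closure_mono (Set.image_subset_iff.2 fun _ h => h)
        (image_closure_subset_closure_image hf ⟨t, ht, rfl⟩)
    · have : {t | IsMMatrix (f t)} =
          ⋃ x ∈ {x : ι → ℝ | ∀ i, 0 < x i}, ⋂ i, {t | 0 < (f t *ᵥ x) i} := by
        ext t
        simp only [Set.mem_ofPred_eq, Set.mem_iUnion, Set.mem_iInter]
        exact ⟨fun h => let ⟨x, hx, h⟩ := h.exists_pos; ⟨x, hx, h⟩,
          fun ⟨x, hx, h⟩ => ⟨hoff t, x, hx, h⟩⟩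
      rw [this]
      exact isOpen_biUnion fun x _ => isOpen_iInter_of_finite fun i =>
        isOpen_lt continuous_const
          ((continuous_apply i).comp (hf.matrix_mulVec continuous_const))
  exact (hclopen.eq_univ ⟨t₀, h₀⟩ ▸ Set.mem_univ t : t ∈ {t | IsMMatrix (f t)})

/-- With the positive vector `x` as weight, the square of `y i * x j - y j * x i` bounds each mixed
term; summing and using symmetry bounds the form below by `∑ y i ^ 2 / x i * (A x) i`. -/
theorem dotProduct_mulVec_nonneg {A : Matrix ι ι ℝ} (hA : IsMMatrix A) (hs : A.IsSymm)
    (y : ι → ℝ) : 0 ≤ y ⬝ᵥ (A *ᵥ y) := by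
  obtain ⟨x, hx, hAx⟩ := hA.exists_pos
  have hle : ∀ i j, A i j * (y i ^ 2 / x i * x j + y j ^ 2 / x j * x i) ≤
      2 * (y i * (A i j * y j)) := by
    intro i j
    rcases eq_or_ne i j with rfl | hij
    · rw [div_mul_cancel₀ _ (hx i).ne']
      apply le_of_eq; ring
    · have h := hA.offDiag_nonpos i j hij
      have h2 : 2 * (y i * y j) ≤ y i ^ 2 / x i * x j + y j ^ 2 / x j * x i := by
        have hi := hx i
        have hj := hx j
        have : y i ^ 2 / x i * x j + y j ^ 2 / x j * x i - 2 * (y i * y j) =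
            (y i * x j - y j * x i) ^ 2 / (x i * x j) := by
          field_simp
          ring
        have h3 : 0 ≤ (y i * x j - y j * x i) ^ 2 / (x i * x j) := by positivity
        linarith
      nlinarith
  have hsum : ∑ i, ∑ j, A i j * (y i ^ 2 / x i * x j + y j ^ 2 / x j * x i) =
      2 * ∑ i, y i ^ 2 / x i * (A *ᵥ x) i := by
    have h1 : ∑ i, ∑ j, A i j * (y i ^ 2 / x i * x j) = ∑ i, y i ^ 2 / x i * (A *ᵥ x) i := by
      refine Finset.sum_congr rfl fun i _ => ?_
      rw [mulVec, dotProduct, Finset.mul_sum]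
      exact Finset.sum_congr rfl fun j _ => by ring
    have h2 : ∑ i, ∑ j, A i j * (y j ^ 2 / x j * x i) = ∑ i, y i ^ 2 / x i * (A *ᵥ x) i := by
      rw [Finset.sum_comm, ← h1]
      exact Finset.sum_congr rfl fun i _ => Finset.sum_congr rfl fun j _ => by rw [hs.apply]
    simp only [mul_add, Finset.sum_add_distrib, h1, h2]
    ring
  have hnn : 0 ≤ ∑ i, y i ^ 2 / x i * (A *ᵥ x) i :=
    Finset.sum_nonneg fun i _ => mul_nonneg (div_nonneg (sq_nonneg _) (hx i).le) (hAx i).le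
  have htot := Finset.sum_le_sum fun i (_ : i ∈ Finset.univ) =>
    Finset.sum_le_sum fun j (_ : j ∈ Finset.univ) => hle i j
  rw [hsum] at htot
  have : ∑ i, ∑ j, 2 * (y i * (A i j * y j)) = 2 * (y ⬝ᵥ (A *ᵥ y)) := by
    simp only [dotProduct, mulVec, Finset.mul_sum]
  linarith

theorem one [DecidableEq ι] : IsMMatrix (1 : Matrix ι ι ℝ) :=
  ⟨fun i j h => by simp [h], 1, by simp, by simp⟩

end IsMMatrix

/-- For a unitriangular `U` with nonpositive off-diagonal entries for which the quadratic form of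
`U + Uᵀ` takes a negative value, the pencil `λ U + Uᵀ` is singular for some `λ > 1`. -/
theorem exists_one_lt_det_smul_add_transpose_eq_zero {N : ℕ} {U : Matrix (Fin N) (Fin N) ℝ}
    (htri : U.BlockTriangular id) (hone : ∀ i, U i i = 1) (hoff : ∀ i j, i ≠ j → U i j ≤ 0)
    {c : Fin N → ℝ} (hc : c ⬝ᵥ ((U + Uᵀ) *ᵥ c) < 0) :
    ∃ r : ℝ, 1 < r ∧ (r • U + Uᵀ).det = 0 := by
  by_contra! hdet
  have hcc : 0 ≤ c ⬝ᵥ c := Finset.sum_nonneg fun i _ => mul_self_nonneg (c i)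
  have hU : IsMMatrix U := by
    have := IsMMatrix.of_path (X := Set.Icc (0 : ℝ) 1)
      (f := fun t => (1 - (t : ℝ)) • (1 : Matrix (Fin N) (Fin N) ℝ) + (t : ℝ) • U)
      (by fun_prop) (fun t i j hij => by
        simpa [hij] using mul_nonpos_of_nonneg_of_nonpos t.2.1 (hoff i j hij))
      (fun t => by
        rw [det_of_isUpperTriangular]
        · simp [hone]
        · intro i j hij
          have h := htri hij
          simp [(show j < i from hij).ne', h])
      (t₀ := ⟨0, by simp⟩) (by simpa using IsMMatrix.one) ⟨1, by simp⟩
    simpa using this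
  have hUdet : U.det = 1 := by rw [det_of_isUpperTriangular htri]; simp [hone]
  -- For `0 < ε < 1` the matrix is `ε (ε⁻¹ U + Uᵀ)` with `ε⁻¹ > 1`, hence nonsingular by assumption;
  -- the path starts at the M-matrix `U`.
  have hpath : ∀ ε : ℝ, ε ∈ Set.Ico (0 : ℝ) 1 → IsMMatrix (U + ε • Uᵀ) := by
    have : PreconnectedSpace (Set.Ico (0 : ℝ) 1) := Subtype.preconnectedSpace isPreconnected_Ico
    intro ε hε
    refine IsMMatrix.of_path (X := Set.Ico (0 : ℝ) 1) (f := fun ε => U + (ε : ℝ) • Uᵀ)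
      (by fun_prop) (fun t i j hij => ?_) (fun t => ?_) (t₀ := ⟨0, by simp⟩) (by simpa using hU)
      ⟨ε, hε⟩
    · have := mul_nonpos_of_nonneg_of_nonpos t.2.1 (hoff j i hij.symm)
      simpa using add_nonpos (hoff i j hij) this
    · obtain ⟨t, ht0, ht1⟩ := t
      rcases ht0.eq_or_lt with rfl | ht0
      · simp [hUdet]
      · have : U + t • Uᵀ = t • (t⁻¹ • U + Uᵀ) := by
          rw [smul_add, smul_smul, mul_inv_cancel₀ ht0.ne', one_smul]
        simp only [this, det_smul]
        exact mul_ne_zero (pow_ne_zero _ ht0.ne') (hdet _ ((one_lt_inv₀ ht0).2 ht1))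
  set A := U + Uᵀ with hA
  -- `U + Uᵀ` itself may be singular. A positive shift `μ` off the finitely many eigenvalues of `-A`
  -- repairs this, and it is small enough to keep the form negative at `c`; the `+ 1` keeps the
  -- denominator visibly positive.
  obtain ⟨μ, ⟨hμ0, hμ1⟩, hμ⟩ := (Set.Ioo_infinite (a := (0 : ℝ))
    (b := -(c ⬝ᵥ (A *ᵥ c)) / (c ⬝ᵥ c + 1))
    (div_pos (by linarith) (by linarith))).exists_notMem_finset
    ((-A).charpoly.roots.toFinset)
  have hd : (A + μ • (1 : Matrix (Fin N) (Fin N) ℝ)).det ≠ 0 := by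
    intro h
    apply hμ
    rw [Multiset.mem_toFinset, Polynomial.mem_roots (charpoly_monic _).ne_zero,
      Polynomial.IsRoot, eval_charpoly, sub_neg_eq_add, add_comm, ← h, smul_one_eq_diagonal]
    rfl
  have hM : IsMMatrix (A + μ • (1 : Matrix (Fin N) (Fin N) ℝ)) := by
    refine IsMMatrix.of_mem_closure ?_ hd
    have hcont : Continuous fun ε : ℝ => U + ε • Uᵀ + μ • (1 : Matrix (Fin N) (Fin N) ℝ) := by
      fun_prop
    have h1 : (1 : ℝ) ∈ closure (Set.Ico (0 : ℝ) 1) := by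
      rw [closure_Ico zero_ne_one]; simp
    have := image_closure_subset_closure_image hcont ⟨1, h1, rfl⟩
    simp only [one_smul] at this
    exact closure_mono (Set.image_subset_iff.2 fun ε hε => (hpath ε hε).add_smul_one hμ0.le) this
  have hsymm : (A + μ • (1 : Matrix (Fin N) (Fin N) ℝ)).IsSymm := by
    simp [IsSymm, hA, add_comm]
  have hnn := hM.dotProduct_mulVec_nonneg hsymm c
  rw [lt_div_iff₀ (by linarith)] at hμ1
  simp only [add_mulVec, smul_mulVec, one_mulVec, dotProduct_add, dotProduct_smul,
    smul_eq_mul] at hnn hμ1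
  linarith

end MMatrix

/-! ## The characteristic polynomial of a product of reflections -/

section CoxeterElement

open Matrix

variable {n N : ℕ}

theorem lorentz_comm (x y : Fin (n + 1) → ℝ) : lorentz x y = lorentz y x := by
  simp [lorentz, mul_comm]

/-- The upper unitriangular matrix `U` such that `U + Uᵀ` is twice the Gram matrix of the unit
vectors `e`. -/
noncomputable def gramUpper (e : Fin N → Fin (n + 1) → ℝ) : Matrix (Fin N) (Fin N) ℝ :=
  of fun i j => if i < j then 2 * lorentz (e i) (e j) else if i = j then 1 else 0

theorem gramUpper_add_transpose {e : Fin N → Fin (n + 1) → ℝ} (he : ∀ i, lorentz (e i) (e i) = 1) :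
    gramUpper e + (gramUpper e)ᵀ = (2 : ℝ) • of fun i j => lorentz (e i) (e j) := by
  ext i j
  rcases lt_trichotomy i j with h | rfl | h
  · simp [gramUpper, h, h.not_gt, h.ne']
  · simp [gramUpper, he]; norm_num
  · simp [gramUpper, h, h.not_gt, h.ne', lorentz_comm (e j)]

theorem isUpperTriangular_gramUpper (e : Fin N → Fin (n + 1) → ℝ) :
    (gramUpper e).IsUpperTriangular := by
  intro i j hij
  have h : j < i := hij
  simp [gramUpper, h.not_gt, h.ne']

theorem det_gramUpper (e : Fin N → Fin (n + 1) → ℝ) : (gramUpper e).det = 1 := by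
  rw [det_of_isUpperTriangular (isUpperTriangular_gramUpper e)]
  simp [gramUpper]

theorem of_mul_lorentzMatrix_mul_transpose (e : Fin N → Fin (n + 1) → ℝ) :
    of e * lorentzMatrix n * (of e)ᵀ = of fun i j => lorentz (e i) (e j) := by
  ext i j
  rw [of_apply, lorentz_comm, lorentz_eq_dotProduct, Matrix.mul_assoc, mul_apply, dotProduct_comm]
  simp [dotProduct, mulVec, mul_apply]

/-- This is `s₁ ⋯ s_N = 1 - 2 Eᵀ U⁻¹ E J`, where `E` has rows `eᵢ`, with `c` in place of `2 U⁻¹ E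
J`. Multiplying on the left by one more reflection adds one row on top of `c`, which is back
substitution for the upper triangular `U`. -/
theorem exists_prod_reflectionMatrix_eq (e : Fin N → Fin (n + 1) → ℝ) :
    ∃ c : Matrix (Fin N) (Fin (n + 1)) ℝ,
      gramUpper e * c = (2 : ℝ) • (of e * lorentzMatrix n) ∧
      (List.ofFn fun k => reflectionMatrix (e k)).prod = 1 - (of e)ᵀ * c := by
  induction N with
  | zero => exact ⟨0, by ext i; exact i.elim0, by simp⟩
  | succ N ih =>
    obtain ⟨c, hc, hprod⟩ := ih fun k : Fin N => e k.succ
    set M := 1 - (of fun k : Fin N => e k.succ)ᵀ * c with hM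
    set v := ((2 : ℝ) • (lorentzMatrix n *ᵥ e 0)) ᵥ* M with hv
    obtain ⟨d, hd0, hds⟩ : ∃ d : Matrix (Fin (N + 1)) (Fin (n + 1)) ℝ,
        (∀ j, d 0 j = v j) ∧ ∀ k j, d (Fin.succ k) j = c k j :=
      ⟨of (Fin.cons (α := fun _ => Fin (n + 1) → ℝ) v c), fun _ => rfl, fun _ _ => rfl⟩
    refine ⟨d, ?_, ?_⟩
    · ext i j
      refine Fin.cases ?_ (fun i => ?_) i
      · have h1 : ∀ k, ((2 : ℝ) • (lorentzMatrix n *ᵥ e 0)) ⬝ᵥ e k = 2 * lorentz (e 0) (e k) := by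
          intro k
          rw [smul_dotProduct, ← lorentz_eq_dotProduct, smul_eq_mul]
        have h2 : v = (2 : ℝ) • (lorentzMatrix n *ᵥ e 0) -
            (fun k : Fin N => 2 * lorentz (e 0) (e k.succ)) ᵥ* c := by
          rw [hv, hM, vecMul_sub, vecMul_one, ← vecMul_vecMul]
          congr 2
          ext k
          exact h1 k.succ
        rw [mul_apply, Fin.sum_univ_succ]
        simp only [gramUpper, of_apply, hd0, hds, h2, Fin.succ_pos, if_true,
          lt_irrefl, if_false, Pi.sub_apply, one_mul, vecMul, dotProduct, sub_add_cancel]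
        simp [mul_apply, mulVec_diagonal, lorentzMatrix, diagonal_apply]
      · have := congrFun (congrFun hc i) j
        rw [mul_apply, Fin.sum_univ_succ]
        rw [mul_apply] at this
        simpa [gramUpper, Fin.succ_ne_zero, mul_apply, hds] using this
    · rw [List.ofFn_succ, List.prod_cons, hprod, reflectionMatrix, sub_mul, one_mul,
        smul_mul_assoc, vecMulVec_mul]
      have h3 : (of e)ᵀ * d = vecMulVec (e 0) v + (of fun k : Fin N => e k.succ)ᵀ * c := by
        ext i j
        rw [mul_apply, Fin.sum_univ_succ]
        simp [vecMulVec_apply, mul_apply, hd0, hds]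
      rw [h3, hv, smul_vecMul, vecMulVec_smul, hM]
      abel

/-- With `a = r - 1`, one has `r - C = a + Eᵀ c` and `r U + Uᵀ = a U + 2 G = U (a + c Eᵀ)`, so `det
(1 + X Y) = det (1 + Y X)` compares them. The powers of `a` account for the different sizes `n + 1`
and `N`. -/
theorem eval_charpoly_prod_reflectionMatrix {e : Fin N → Fin (n + 1) → ℝ}
    (he : ∀ i, lorentz (e i) (e i) = 1) {r : ℝ} (hr : r ≠ 1) :
    (List.ofFn fun k => reflectionMatrix (e k)).prod.charpoly.eval r * (r - 1) ^ N =
      (r - 1) ^ (n + 1) * (r • gramUpper e + (gramUpper e)ᵀ).det := by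
  obtain ⟨c, hc, hprod⟩ := exists_prod_reflectionMatrix_eq e
  have ha : r - 1 ≠ 0 := sub_ne_zero.2 hr
  set a := r - 1 with ha'
  have h1 : scalar (Fin (n + 1)) r - (1 - (of e)ᵀ * c) = a • (1 + (a⁻¹ • (of e)ᵀ) * c) := by
    rw [Matrix.smul_mul, smul_add, smul_smul, mul_inv_cancel₀ ha, one_smul, ha', sub_smul,
      one_smul, show scalar (Fin (n + 1)) r = r • (1 : Matrix _ _ ℝ) from (smul_one_eq_diagonal r).symm]
    abel
  have h2 : r • gramUpper e + (gramUpper e)ᵀ =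
      gramUpper e * (a • (1 + c * (a⁻¹ • (of e)ᵀ))) := by
    rw [Matrix.mul_smul c, smul_add, smul_smul, mul_inv_cancel₀ ha, one_smul, mul_add,
      mul_smul_comm, mul_one, ← Matrix.mul_assoc, hc, Matrix.smul_mul, of_mul_lorentzMatrix_mul_transpose,
      ← gramUpper_add_transpose he, ha', sub_smul, one_smul]
    abel
  rw [eval_charpoly, hprod, h1, h2, det_mul, det_gramUpper, one_mul, det_smul, det_smul,
    det_one_add_mul_comm]
  simp only [Fintype.card_fin]
  ring

namespace CoxeterPolyhedron

variable (P : CoxeterPolyhedron n N) (π : Equiv.Perm (Fin N))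

theorem val_coxeterTransformation : (P.coxeterTransformation π).val =
    (List.ofFn fun k => reflectionMatrix (P.normal (π k))).prod := by
  rw [coxeterTransformation, ← Units.coeHom_apply, map_list_prod, List.map_ofFn]
  rfl

theorem coxeterTransformation_mem : P.coxeterTransformation π ∈ P.coxeterGroup := by
  refine Subgroup.list_prod_mem _ fun g hg => ?_
  obtain ⟨k, rfl⟩ := (List.mem_ofFn' _ _).1 hg
  exact Subgroup.subset_closure ⟨_, rfl⟩

theorem lorentz_normal_nonpos {i j : Fin N} (hij : i ≠ j) :
    lorentz (P.normal i) (P.normal j) ≤ 0 := by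
  rcases P.angles i j hij with ⟨m, hm, h⟩ | h
  · rw [h, neg_nonpos]
    have hm' : (2 : ℝ) ≤ m := by exact_mod_cast hm
    refine Real.cos_nonneg_of_mem_Icc ⟨?_, ?_⟩
    · have : 0 ≤ Real.pi / m := by positivity
      linarith [Real.pi_pos]
    · exact div_le_div_of_nonneg_left Real.pi_pos.le two_pos hm'
  · linarith

/-- If the Gram matrix takes a negative value, then the Coxeter transformations have an
eigenvalue greater than `1`. -/
theorem exists_one_lt_isRoot_charpoly {c : Fin N → ℝ} (hc : c ⬝ᵥ (P.gram *ᵥ c) < 0) :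
    ∃ r : ℝ, 1 < r ∧ (P.coxeterTransformation π).val.charpoly.IsRoot r := by
  set e := fun k => P.normal (π k)
  have he : ∀ i, lorentz (e i) (e i) = 1 := fun i => P.unit _
  obtain ⟨r, hr, hdet⟩ := exists_one_lt_det_smul_add_transpose_eq_zero (U := gramUpper e)
    (c := c ∘ π) (isUpperTriangular_gramUpper e) (fun i => by simp [gramUpper])
    (fun i j hij => by
      have := P.lorentz_normal_nonpos (π.injective.ne hij)
      simp only [gramUpper, of_apply, hij, if_false]
      split_ifs
      · linarith
      · rfl)
    (by
      have hg : (of fun i j => lorentz (e i) (e j)) = P.gram.submatrix π π := rfl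
      rw [gramUpper_add_transpose he, smul_mulVec, dotProduct_smul, hg, submatrix_mulVec_equiv,
        comp_equiv_dotProduct_comp_equiv]
      have : (c ∘ π) ∘ π.symm = c := by ext; simp
      rw [this, smul_eq_mul]
      linarith)
  refine ⟨r, hr, ?_⟩
  have h := eval_charpoly_prod_reflectionMatrix he hr.ne'
  rw [hdet, mul_zero] at h
  rw [val_coxeterTransformation]
  exact (mul_eq_zero.1 h).resolve_right (pow_ne_zero _ (sub_pos.2 hr).ne')

end CoxeterPolyhedron

end CoxeterElement

/-! ## The Vinberg field contains the Coxeter field -/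

section Cycles

open Matrix

/-- If all the cyclic products `a (i 0) (i 1) * ⋯ * a (i l) (i 0)` lie in a submonoid, then so do
all the products `∏ i, a i (σ i)` for permutations `σ`. -/
theorem prod_perm_mem_of_cycles_mem {ι R : Type*} [Fintype ι] [DecidableEq ι] [CommMonoid R]
    (S : Submonoid R) (a : ι → ι → R)
    (h : ∀ (l : ℕ) (i : Fin (l + 1) → ι), ∏ k, a (i k) (i (k + 1)) ∈ S) (σ : Equiv.Perm ι) :
    ∏ i, a i (σ i) ∈ S := by
  have hfix : ∀ i, a i i ∈ S := fun i => by simpa using h 0 fun _ => i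
  -- Only the support is treated by cycle induction; fixed points are cycles of length one and are
  -- added afterwards.
  have hsupp : ∏ i ∈ σ.support, a i (σ i) ∈ S := by
    induction σ using Equiv.Perm.cycle_induction_on with
    | base_one => simp
    | base_cycles σ hσ =>
      obtain ⟨x, hx, -⟩ := id hσ
      obtain ⟨l, hl⟩ := Nat.exists_eq_succ_of_ne_zero (orderOf_pos σ).ne'
      have hc := h l fun k => (σ ^ (k : ℕ)) x
      -- The wrap-around of `k + 1` in `Fin (l + 1)` is harmless because `σ` has order `l + 1`.
      have hstep : ∀ k : Fin (l + 1), (σ ^ ((k + 1 : Fin (l + 1)) : ℕ)) x =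
          σ ((σ ^ (k : ℕ)) x) := by
        intro k
        rw [← Equiv.Perm.mul_apply, ← pow_succ', ← pow_mod_orderOf σ ((k : ℕ) + 1), hl]
        congr 2
        simp [Fin.val_add]
      simp only [hstep] at hc
      convert hc using 1
      symm
      refine Finset.prod_bij (fun k _ => (σ ^ (k : ℕ)) x) (fun k _ => ?_) (fun k _ m _ hkm => ?_)
        (fun y hy => ?_) fun _ _ => rfl
      · exact Equiv.Perm.pow_apply_mem_support.2 (Equiv.Perm.mem_support.2 hx)
      · have := hσ.pow_eq_pow_iff.2 ⟨x, hx, hkm⟩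
        exact Fin.ext (pow_injOn_Iio_orderOf (by simpa [hl] using k.2) (by simpa [hl] using m.2)
          this)
      · obtain ⟨k, rfl⟩ := hσ.exists_pow_eq hx (Equiv.Perm.mem_support.1 hy)
        refine ⟨⟨k % orderOf σ, (Nat.mod_lt _ (orderOf_pos σ)).trans_eq hl⟩, Finset.mem_univ _, ?_⟩
        simp [pow_mod_orderOf]
    | induction_disjoint σ τ hd _ hσ hτ =>
      rw [hd.support_mul, Finset.prod_union (Equiv.Perm.disjoint_iff_disjoint_support.1 hd)]
      refine S.mul_mem ?_ ?_
      · convert hσ using 1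
        refine Finset.prod_congr rfl fun i hi => ?_
        rw [Equiv.Perm.mul_apply, (hd i).resolve_left (Equiv.Perm.mem_support.1 hi)]
      · convert hτ using 1
        refine Finset.prod_congr rfl fun i hi => ?_
        rw [hd.commute.eq, Equiv.Perm.mul_apply, (hd i).resolve_right (Equiv.Perm.mem_support.1 hi)]
  rw [← Finset.prod_sdiff (Finset.subset_univ σ.support)]
  refine S.mul_mem (S.prod_mem fun i hi => ?_) hsupp
  rw [Finset.mem_sdiff, Equiv.Perm.mem_support, not_not] at hi
  rw [hi.2]
  exact hfix i

/-- A polynomial with values in a subfield at the rational numbers other than `1` has its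
coefficients in the subfield. -/
theorem coeff_mem_of_eval_mem (K : IntermediateField ℚ ℝ) (f : Polynomial ℝ)
    (hf : ∀ q : ℚ, q ≠ 1 → f.eval (q : ℝ) ∈ K) (j : ℕ) : f.coeff j ∈ K := by
  have hq : ∀ i : Fin (f.natDegree + 1), ((i : ℕ) : ℚ) + 2 ≠ 1 := fun i => by
    have : (0 : ℚ) ≤ (i : ℕ) := Nat.cast_nonneg _
    linarith
  -- The nodes `2, 3, …` avoid the excluded value `1`.
  let v : Fin (f.natDegree + 1) → K := fun i => ((i : ℕ) : K) + 2
  have hv : Function.Injective v := fun i j hij => by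
    simpa [v, Fin.ext_iff] using hij
  let p := Lagrange.interpolate Finset.univ v fun i =>
    (⟨f.eval _, hf _ (hq i)⟩ : K)
  have hp : p.map (algebraMap K ℝ) = f := by
    refine Polynomial.eq_of_degrees_lt_of_eval_index_eq Finset.univ
      (v := fun i => algebraMap K ℝ (v i)) (((algebraMap K ℝ).injective.comp hv).injOn) ?_ ?_ ?_
    · exact (Polynomial.degree_map_le).trans_lt (Lagrange.degree_interpolate_lt _ hv.injOn)
    · rw [Finset.card_univ, Fintype.card_fin]
      exact Polynomial.degree_le_natDegree.trans_lt (by exact_mod_cast Nat.lt_succ_self _)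
    · intro i _
      rw [Polynomial.eval_map_apply, Lagrange.eval_interpolate_at_node _ hv.injOn
        (Finset.mem_univ i)]
      simp only [v, map_add, map_natCast, map_ofNat]
      norm_num
  rw [← hp, Polynomial.coeff_map]
  exact (p.coeff j).2

namespace CoxeterPolyhedron

variable {n N : ℕ} (P : CoxeterPolyhedron n N) (π : Equiv.Perm (Fin N))

theorem cycle_mem_vinbergField {l : ℕ} (i : Fin (l + 1) → Fin N) : P.cycle i ∈ P.vinbergField :=
  IntermediateField.subset_adjoin ℚ _ ⟨l, i, rfl⟩

theorem det_mem_vinbergField (q : ℚ) :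
    ((q : ℝ) • gramUpper (fun k => P.normal (π k)) +
      (gramUpper fun k => P.normal (π k))ᵀ).det ∈ P.vinbergField := by
  -- Diagonal entries of the pencil are `q + 1`, while `2 gᵢᵢ = 2`; hence the factor `(q + 1) / 2`.
  set p : Fin N → Fin N → ℚ := fun i j => if i < j then q else if i = j then (q + 1) / 2 else 1
  have hentry : ∀ i j, ((q : ℝ) • gramUpper (fun k => P.normal (π k)) +
      (gramUpper fun k => P.normal (π k))ᵀ) j i = p j i * (2 * P.gram (π i) (π j)) := by
    intro i j
    rcases lt_trichotomy i j with h | rfl | h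
    · simp [gramUpper, p, h, h.not_gt, h.ne', gram]
    · simp [gramUpper, p, gram, P.unit]
    · simp [gramUpper, p, h, h.not_gt, h.ne', gram, lorentz_comm (P.normal (π i))]
  rw [det_apply']
  refine sum_mem fun σ _ => mul_mem (intCast_mem _ _) ?_
  simp only [hentry, Finset.prod_mul_distrib (f := fun i => ((p (σ i) i : ℚ) : ℝ))]
  refine mul_mem (prod_mem fun i _ => SubfieldClass.ratCast_mem _ _) ?_
  exact prod_perm_mem_of_cycles_mem P.vinbergField.toSubfield.toSubmonoid
    (fun i j => 2 * P.gram (π i) (π j)) (fun l i => P.cycle_mem_vinbergField fun k => π (i k)) σ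

theorem coxeterField_le_vinbergField :
    coxeterField (P.coxeterTransformation π) ≤ P.vinbergField := by
  refine IntermediateField.adjoin_le_iff.2 ?_
  rintro _ ⟨j, rfl⟩
  refine coeff_mem_of_eval_mem _ _ (fun q hq => ?_) j
  have hq' : (q : ℝ) ≠ 1 := by exact_mod_cast hq
  have h := eval_charpoly_prod_reflectionMatrix (e := fun k => P.normal (π k))
    (fun i => P.unit _) hq'
  rw [val_coxeterTransformation, eq_div_of_mul_eq (pow_ne_zero _ (sub_ne_zero.2 hq')) h]
  have hq1 : (q : ℝ) - 1 ∈ P.vinbergField := sub_mem (SubfieldClass.ratCast_mem _ q) (one_mem _)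
  exact div_mem (mul_mem (pow_mem hq1 _) (P.det_mem_vinbergField π q)) (pow_mem hq1 _)

/-- Each `1 - sᵢ` is the rank-one matrix `2 eᵢ (J eᵢ)ᵀ`, so a product contracts to scalars times one
rank-one matrix; its trace supplies the factor that closes the cycle. -/
theorem prod_one_sub_reflectionMatrix {l : ℕ} (i : Fin (l + 1) → Fin N) :
    (List.ofFn fun k => 1 - reflectionMatrix (P.normal (i k))).prod =
      (∏ k : Fin l, 2 * P.gram (i k.castSucc) (i k.succ)) •
        (2 : ℝ) • vecMulVec (P.normal (i 0)) (lorentzMatrix n *ᵥ P.normal (i (Fin.last l))) := by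
  induction l with
  | zero => simp [reflectionMatrix]
  | succ l ih =>
    rw [List.ofFn_succ, List.prod_cons, ih fun k => i k.succ, Fin.prod_univ_succ, reflectionMatrix,
      sub_sub_cancel, smul_mul_assoc, mul_smul_comm, mul_smul_comm, vecMulVec_mul_vecMulVec,
      ← lorentz_eq_dotProduct]
    simp only [vecMulVec_smul, smul_smul, Fin.succ_last, Fin.castSucc_zero, Fin.succ_castSucc]
    congr 1
    simp only [gram, of_apply]
    ring

theorem trace_prod_one_sub_reflectionMatrix {l : ℕ} (i : Fin (l + 1) → Fin N) :
    (List.ofFn fun k => 1 - reflectionMatrix (P.normal (i k))).prod.trace = P.cycle i := by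
  rw [prod_one_sub_reflectionMatrix, trace_smul, trace_smul, trace_vecMulVec, dotProduct_comm,
    ← lorentz_eq_dotProduct, cycle, Fin.prod_univ_castSucc, Fin.last_add_one]
  simp [gram]

end CoxeterPolyhedron

end Cycles

/-! ## The normal vectors of a polyhedron of finite volume span -/

section Volume

open Matrix Topology MeasureTheory Filter

variable {n N : ℕ}

theorem continuous_lorentz : Continuous fun p : (Fin (n + 1) → ℝ) × (Fin (n + 1) → ℝ) =>
    lorentz p.1 p.2 := by
  unfold lorentz
  fun_prop

theorem lorentz_add_left (x y w : Fin (n + 1) → ℝ) :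
    lorentz (x + y) w = lorentz x w + lorentz y w := by
  simp only [lorentz_eq_dotProduct, mulVec_add, add_dotProduct]

theorem lorentz_smul_left (a : ℝ) (x w : Fin (n + 1) → ℝ) :
    lorentz (a • x) w = a * lorentz x w := by
  simp only [lorentz_eq_dotProduct, mulVec_smul, smul_dotProduct, smul_eq_mul]

/-- A null vector with last coordinate zero vanishes. -/
theorem eq_zero_of_lorentz_self_eq_zero {z : Fin (n + 1) → ℝ} (h : lorentz z z = 0)
    (hl : z (Fin.last n) = 0) : z = 0 := by
  have h1 : ∑ i : Fin n, z i.castSucc * z i.castSucc = 0 := by simpa [lorentz, hl] using h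
  rw [Finset.sum_eq_zero_iff_of_nonneg fun _ _ => mul_self_nonneg _] at h1
  ext i
  refine Fin.lastCases hl (fun i => ?_) i
  exact mul_self_eq_zero.1 (h1 i (Finset.mem_univ i))

theorem hyperboloidPoint_mem {x : Fin n → ℝ} : hyperboloidPoint x ∈ hyperbolicSpace n := by
  have h : 0 < 1 + ∑ i, x i ^ 2 :=
    add_pos_of_pos_of_nonneg one_pos (Finset.sum_nonneg fun _ _ => sq_nonneg _)
  refine ⟨?_, ?_⟩
  · simp only [lorentz, hyperboloidPoint, Fin.snoc_castSucc, Fin.snoc_last,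
      Real.mul_self_sqrt h.le]
    simp [← sq]
  · simpa [hyperboloidPoint] using h

/-- Rescaled by `1 / r`, the point over `r u` tends to the null vector `(u, |u|)` as `r → ∞`. Strict
inequalities at an ideal point therefore persist far out in a cone around it. -/
theorem hyperboloidPoint_smul {r : ℝ} (hr : 0 < r) (u : Fin n → ℝ) :
    hyperboloidPoint (r • u) =
      r • (Fin.snoc (α := fun _ => ℝ) u (√((r ^ 2)⁻¹ + ∑ i, u i ^ 2)) : Fin (n + 1) → ℝ) := by
  ext i
  refine Fin.lastCases ?_ (fun i => ?_) i
  · simp only [hyperboloidPoint, Fin.snoc_last, Pi.smul_apply, smul_eq_mul]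
    rw [← Real.sqrt_sq hr.le, ← Real.sqrt_mul (sq_nonneg r), Real.sqrt_sq hr.le, mul_add,
      mul_inv_cancel₀ (pow_pos hr 2).ne', Finset.mul_sum]
    simp [mul_pow]
  · simp [hyperboloidPoint]

theorem continuous_snoc_sqrt : Continuous fun p : (Fin n → ℝ) × ℝ =>
    (Fin.snoc (α := fun _ => ℝ) p.1 (√(p.2 + ∑ i, p.1 i ^ 2)) : Fin (n + 1) → ℝ) := by
  refine continuous_pi fun i => ?_
  refine Fin.lastCases ?_ (fun i => ?_) i
  · simp only [Fin.snoc_last]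
    fun_prop
  · simp only [Fin.snoc_castSucc]
    fun_prop

namespace CoxeterPolyhedron

variable (P : CoxeterPolyhedron n N)

/-- A polyhedron that contains a neighbourhood of an ideal point has infinite volume. -/
theorem hyperbolicVolume_carrier_eq_top (hn : 2 ≤ n) {z : Fin (n + 1) → ℝ}
    (hz : lorentz z z = 0) (hlast : 0 < z (Fin.last n)) (hneg : ∀ i, lorentz z (P.normal i) < 0) :
    hyperbolicVolume P.carrier = ⊤ := by
  set z' : Fin n → ℝ := fun i => z i.castSucc with hz'
  have hsnoc : (Fin.snoc (α := fun _ => ℝ) z' (√(0 + ∑ i, z' i ^ 2)) : Fin (n + 1) → ℝ) = z := by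
    have h1 : ∑ i, z' i ^ 2 = z (Fin.last n) ^ 2 := by
      simp only [hz', sq]
      unfold lorentz at hz
      linarith
    rw [zero_add, h1, Real.sqrt_sq hlast.le]
    exact Fin.snoc_init_self z
  set M : ℝ := 2 + ∑ i, z' i ^ 2 with hM
  have hMpos : 0 < M := by
    have : 0 ≤ ∑ i, z' i ^ 2 := Finset.sum_nonneg fun _ _ => sq_nonneg _
    linarith
  have hev : ∀ᶠ p : (Fin n → ℝ) × ℝ in 𝓝 (z', 0),
      (∀ i, lorentz (Fin.snoc (α := fun _ => ℝ) p.1 (√(p.2 + ∑ i, p.1 i ^ 2)) :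
        Fin (n + 1) → ℝ) (P.normal i) < 0) ∧ 1 + ∑ i, p.1 i ^ 2 < M := by
    refine (eventually_all.2 fun i => ?_).and ?_
    · have hc := continuous_lorentz.comp
        (continuous_snoc_sqrt.prodMk (continuous_const (y := P.normal i)))
      refine hc.continuousAt.eventually (gt_mem_nhds ?_)
      simp only [Function.comp_apply, hsnoc]
      exact hneg i
    · have hc : Continuous fun p : (Fin n → ℝ) × ℝ => 1 + ∑ i, p.1 i ^ 2 := by fun_prop
      refine hc.continuousAt.eventually (gt_mem_nhds ?_)
      simp only [hM]
      linarith
  obtain ⟨δ, hδ, hball⟩ := Metric.eventually_nhds_iff.1 hev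
  -- The sup-norm ball of radius `r δ` about `r z'` has Euclidean volume `(2 r δ) ^ n`, and the
  -- density on it is at least `1 / (r M)`. Since `n ≥ 2`, the volume grows at least linearly in
  -- `r`.
  have hlow : ∀ᶠ r : ℝ in atTop, ENNReal.ofReal ((2 * δ) ^ n / M * r) ≤
      hyperbolicVolume P.carrier := by
    have htend : Tendsto (fun r : ℝ => (r ^ 2)⁻¹) atTop (𝓝 0) :=
      (tendsto_pow_atTop two_ne_zero).inv_tendsto_atTop
    filter_upwards [htend.eventually (gt_mem_nhds hδ), eventually_ge_atTop 1] with r hr hr1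
    have hr0 : 0 < r := one_pos.trans_le hr1
    have hp : ∀ x ∈ Metric.ball (r • z') (r * δ), ∃ u, x = r • u ∧
        (∀ i, lorentz (Fin.snoc (α := fun _ => ℝ) u (√((r ^ 2)⁻¹ + ∑ i, u i ^ 2)) :
          Fin (n + 1) → ℝ) (P.normal i) < 0) ∧ 1 + ∑ i, u i ^ 2 < M := by
      intro x hx
      have hx' : x = r • (r⁻¹ • x) := by rw [smul_smul, mul_inv_cancel₀ hr0.ne', one_smul]
      refine ⟨r⁻¹ • x, hx', @hball (r⁻¹ • x, (r ^ 2)⁻¹) ?_⟩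
      rw [hx', Metric.mem_ball, dist_smul₀, Real.norm_of_nonneg hr0.le,
        mul_lt_mul_iff_right₀ hr0] at hx
      refine max_lt hx ?_
      rw [Real.dist_0_eq_abs, abs_of_pos (by positivity)]
      exact hr
    have hsub : Metric.ball (r • z') (r * δ) ⊆ {x | hyperboloidPoint x ∈ P.carrier} := by
      intro x hx
      obtain ⟨u, rfl, hu, -⟩ := hp x hx
      refine ⟨hyperboloidPoint_mem, fun i => ?_⟩
      rw [hyperboloidPoint_smul hr0, lorentz_smul_left]
      exact mul_nonpos_of_nonneg_of_nonpos hr0.le (hu i).le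
    calc ENNReal.ofReal ((2 * δ) ^ n / M * r)
        ≤ ENNReal.ofReal (1 / (r * M)) * volume (Metric.ball (r • z') (r * δ)) := by
          rw [Real.volume_pi_ball _ (by positivity), ← ENNReal.ofReal_mul (by positivity)]
          refine ENNReal.ofReal_le_ofReal ?_
          rw [Fintype.card_fin, show 2 * (r * δ) = r * (2 * δ) by ring, mul_pow r,
            show 1 / (r * M) * (r ^ n * (2 * δ) ^ n) = (2 * δ) ^ n / M * (r ^ n / r) by
              field_simp]
          refine mul_le_mul_of_nonneg_left ?_ (by positivity)
          rw [le_div_iff₀ hr0, ← sq]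
          exact pow_le_pow_right₀ hr1 hn
      _ = ∫⁻ _ in Metric.ball (r • z') (r * δ), ENNReal.ofReal (1 / (r * M)) :=
          (setLIntegral_const _ _).symm
      _ ≤ ∫⁻ x in Metric.ball (r • z') (r * δ),
            ENNReal.ofReal (1 / √(1 + ∑ i, x i ^ 2)) := by
          refine setLIntegral_mono' measurableSet_ball fun x hx => ENNReal.ofReal_le_ofReal ?_
          obtain ⟨u, rfl, -, hu⟩ := hp x hx
          have hS : 0 ≤ ∑ i, u i ^ 2 := Finset.sum_nonneg fun _ _ => sq_nonneg _
          have hsum : ∑ i, (r • u) i ^ 2 = r ^ 2 * ∑ i, u i ^ 2 := by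
            simp [mul_pow, Finset.mul_sum]
          rw [hsum]
          refine one_div_le_one_div_of_le (Real.sqrt_pos.2 (by positivity)) ?_
          refine Real.sqrt_le_iff.2 ⟨by positivity, ?_⟩
          have hr2 : 1 ≤ r ^ 2 := one_le_pow₀ hr1
          calc 1 + r ^ 2 * ∑ i, u i ^ 2 ≤ r ^ 2 * (1 + ∑ i, u i ^ 2) := by linarith
            _ ≤ r ^ 2 * (1 + ∑ i, u i ^ 2) ^ 2 :=
              mul_le_mul_of_nonneg_left (le_self_pow₀ (by linarith) two_ne_zero) (by positivity)
            _ ≤ (r * M) ^ 2 := by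
              rw [mul_pow]
              gcongr
      _ ≤ hyperbolicVolume P.carrier := lintegral_mono_set hsub
  refine top_le_iff.1 (le_of_tendsto ?_ hlow)
  exact ENNReal.tendsto_ofReal_atTop.comp (tendsto_id.const_mul_atTop (by positivity))

/-- A polyhedron of finite volume has a bounding hyperplane. -/
theorem nonempty_of_isCofinite (hn : 2 ≤ n) (hP : P.IsCofinite) : Nonempty (Fin N) := by
  by_contra hN
  rw [not_nonempty_iff] at hN
  have hn' : (0 : ℝ) < n := by exact_mod_cast (by omega : 0 < n)
  refine hP.ne (P.hyperbolicVolume_carrier_eq_top hn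
    -- Without hyperplanes any null vector will do; this one is `(1, …, 1, √n)`.
    (z := Fin.snoc (α := fun _ => ℝ) (fun _ : Fin n => 1) (√n)) ?_ ?_ fun i => isEmptyElim i)
  · simp [lorentz, Real.mul_self_sqrt hn'.le]
  · simpa using hn'

/-- The normal vectors of a polyhedron of finite volume span. -/
theorem eq_zero_of_forall_lorentz_eq_zero (hn : 2 ≤ n) (hP : P.IsCofinite) {v : Fin (n + 1) → ℝ}
    (hv : ∀ i, lorentz v (P.normal i) = 0) : v = 0 := by
  by_contra hv0
  obtain ⟨x, ⟨hx, hxlast⟩, hxneg⟩ := P.interior_nonempty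
  -- Moving from the interior point `x` along `v` changes no product with a normal. Some `x + w` is
  -- not timelike: take a large multiple of `v` if `v` is horizontal, hence spacelike, and otherwise
  -- cancel the last coordinate. The segment then meets the light cone in a null vector satisfying
  -- all strict inequalities.
  obtain ⟨w, hw, hw1, hw2⟩ : ∃ w, (∀ i, lorentz w (P.normal i) = 0) ∧
      0 ≤ lorentz (x + w) (x + w) ∧ 0 ≤ (x + w) (Fin.last n) := by
    by_cases hvl : v (Fin.last n) = 0
    · have hvv : 0 < lorentz v v := by
        refine lt_of_le_of_ne ?_ fun h => hv0 (eq_zero_of_lorentz_self_eq_zero h.symm hvl)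
        simpa [lorentz, hvl] using Finset.sum_nonneg fun (i : Fin n) _ =>
          mul_self_nonneg (v i.castSucc)
      obtain ⟨t, ht⟩ : ∃ t : ℝ, 0 ≤ -1 + 2 * t * lorentz x v + t ^ 2 * lorentz v v := by
        set b := lorentz x v
        set a := lorentz v v
        -- With this `t`, `t (a t + 2 b) ≥ t (1 + a) ≥ 1`.
        refine ⟨(2 * |b| + 1 + a) / a, ?_⟩
        have hb := abs_nonneg b
        have hb' := neg_abs_le b
        have : -1 + 2 * ((2 * |b| + 1 + a) / a) * b + ((2 * |b| + 1 + a) / a) ^ 2 * a =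
            ((2 * |b| + 1 + a) * (2 * (b + |b|) + 1 + a) - a) / a := by
          field_simp
          ring
        rw [this]
        refine div_nonneg ?_ hvv.le
        nlinarith [mul_nonneg hb (by linarith : 0 ≤ b + |b|), mul_pos hvv hvv]
      refine ⟨t • v, fun i => by rw [lorentz_smul_left, hv, mul_zero], ?_, ?_⟩
      · convert ht using 1
        rw [lorentz_add_left, lorentz_comm x, lorentz_comm (t • v), lorentz_add_left,
          lorentz_add_left, hx, lorentz_smul_left, lorentz_comm x (t • v), lorentz_smul_left,
          lorentz_smul_left, lorentz_comm v (t • v), lorentz_smul_left, lorentz_comm v x]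
        ring
      · simpa [hvl] using hxlast.le
    · refine ⟨(-(x (Fin.last n) / v (Fin.last n))) • v,
        fun i => by rw [lorentz_smul_left, hv, mul_zero], ?_, ?_⟩
      all_goals
        have h0 : (x + (-(x (Fin.last n) / v (Fin.last n))) • v) (Fin.last n) = 0 := by
          simp [div_mul_cancel₀ _ hvl]
      · rw [lorentz, h0, mul_zero, sub_zero]
        exact Finset.sum_nonneg fun i _ => mul_self_nonneg _
      · exact h0.ge
  have hcont : Continuous fun s : ℝ => lorentz (x + s • w) (x + s • w) :=
    continuous_lorentz.comp
      (show Continuous fun s : ℝ => (x + s • w, x + s • w) by fun_prop)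
  obtain ⟨s, ⟨hs0, hs1⟩, hs⟩ := intermediate_value_Icc zero_le_one hcont.continuousOn
    (show (0 : ℝ) ∈ _ from ⟨by simp [hx], by simpa using hw1⟩)
  have hneg : ∀ i, lorentz (x + s • w) (P.normal i) < 0 := fun i => by
    rw [lorentz_add_left, lorentz_smul_left, hw, mul_zero, add_zero]
    exact hxneg i
  have hlast : 0 ≤ (x + s • w) (Fin.last n) := by
    simp only [Pi.add_apply, Pi.smul_apply, smul_eq_mul] at hw2 ⊢
    nlinarith [mul_nonneg hs0 hw2, mul_nonneg (sub_nonneg.2 hs1) hxlast.le]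
  -- Last coordinate zero would make the null vector zero, contradicting a strict inequality for any
  -- normal.
  rcases hlast.eq_or_lt with h | h
  · obtain ⟨i⟩ := P.nonempty_of_isCofinite hn hP
    have := hneg i
    rw [eq_zero_of_lorentz_self_eq_zero hs h.symm] at this
    simp [lorentz] at this
  · exact hP.ne (P.hyperbolicVolume_carrier_eq_top hn hs h hneg)

/-- The quadratic form of the Gram matrix of a polyhedron of finite volume takes a negative
value. -/
theorem exists_dotProduct_gram_neg (hn : 2 ≤ n) (hP : P.IsCofinite) :
    ∃ c : Fin N → ℝ, c ⬝ᵥ (P.gram *ᵥ c) < 0 := by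
  have hinj : LinearMap.ker (toLin' (of P.normal)) = ⊥ := by
    refine LinearMap.ker_eq_bot'.2 fun u hu => ?_
    have hJ : lorentzMatrix n *ᵥ (lorentzMatrix n *ᵥ u) = u := by
      ext i
      simp only [lorentzMatrix, mulVec_diagonal]
      split_ifs <;> simp
    rw [← hJ, P.eq_zero_of_forall_lorentz_eq_zero hn hP (v := lorentzMatrix n *ᵥ u), mulVec_zero]
    intro i
    rw [lorentz_eq_dotProduct, hJ, dotProduct_comm]
    exact congrFun hu i
  -- A left inverse `B` of the matrix of normals gives `B G Bᵀ = J`; the last row of `B` realizes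
  -- the diagonal entry `-1`.
  obtain ⟨g, hg⟩ := LinearMap.exists_leftInverse_of_injective _ hinj
  have hB : LinearMap.toMatrix' g * of P.normal = 1 := by
    have := congrArg LinearMap.toMatrix' hg
    rwa [LinearMap.toMatrix'_comp, LinearMap.toMatrix'_toLin', LinearMap.toMatrix'_id] at this
  set B := LinearMap.toMatrix' g
  refine ⟨B (Fin.last n), ?_⟩
  have hG : B * P.gram * Bᵀ = lorentzMatrix n := by
    have h1 : P.gram = of P.normal * lorentzMatrix n * (of P.normal)ᵀ :=
      (of_mul_lorentzMatrix_mul_transpose _).symm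
    calc B * P.gram * Bᵀ = (B * of P.normal) * lorentzMatrix n * (B * of P.normal)ᵀ := by
          rw [h1, transpose_mul]
          simp only [Matrix.mul_assoc]
      _ = lorentzMatrix n := by rw [hB]; simp
  have h2 : B (Fin.last n) ⬝ᵥ (P.gram *ᵥ B (Fin.last n)) =
      (B * P.gram * Bᵀ) (Fin.last n) (Fin.last n) := by
    rw [Matrix.mul_assoc]
    rfl
  rw [h2, hG]
  simp [lorentzMatrix]

end CoxeterPolyhedron

end Volume

/-! ## The field of definition of a quasi-arithmetic group -/

section FieldOfDefinition

open Matrix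

/-- A totally real number field `F ⊂ ℝ` is contained in `L` if the inclusion is the only real
embedding of `F` that fixes `F ∩ L`. -/
theorem le_of_forall_embedding_eq (F L : IntermediateField ℚ ℝ) [NumberField F]
    [NumberField.IsTotallyReal F]
    (h : ∀ σ : F →+* ℝ, (∀ x : F, (x : ℝ) ∈ L → σ x = x) → σ = algebraMap F ℝ) : F ≤ L := by
  let E : IntermediateField ℚ F := L.comap F.val
  let ψ : F →+* ℂ := Complex.ofRealHom.comp (algebraMap F ℝ)
  let _ : Algebra E ℂ := (ψ.comp (algebraMap E F)).toAlgebra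
  -- The degree of `F` over `E = F ∩ L` is the number of `E`-embeddings of `F` into `ℂ`. All of them
  -- are real, so by hypothesis only the inclusion occurs.
  have huniq : ∀ φ : F →ₐ[E] ℂ, φ.toRingHom = ψ := by
    intro φ
    have hreal := NumberField.IsTotallyReal.complexEmbedding_isReal φ.toRingHom
    have hσ := h hreal.embedding fun x hx => by
      apply Complex.ofReal_injective
      rw [hreal.coe_embedding_apply]
      exact φ.commutes ⟨x, hx⟩
    ext x
    rw [← hreal.coe_embedding_apply, hσ]
    rfl
  have hcard : Module.finrank E F ≤ 1 := by
    rw [← AlgHom.card E F ℂ, Fintype.card_le_one_iff]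
    intro φ φ'
    ext x
    exact RingHom.congr_fun ((huniq φ).trans (huniq φ').symm) x
  have hE : E = ⊤ := IntermediateField.finrank_eq_one_iff_eq_top.1
    (le_antisymm hcard Module.finrank_pos)
  intro x hx
  exact (hE ▸ IntermediateField.mem_top : (⟨x, hx⟩ : F) ∈ E)

variable {m : Type*} [Fintype m] [DecidableEq m]

/-- A matrix that preserves a positive definite form has no eigenvalue greater than `1`. -/
theorem not_isRoot_charpoly_of_posDef {Q A : Matrix m m ℝ} (hQ : Q.PosDef) (hA : Aᵀ * Q * A = Q)
    {r : ℝ} (hr : 1 < r) : ¬ A.charpoly.IsRoot r := by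
  intro hroot
  rw [Polynomial.IsRoot, eval_charpoly] at hroot
  obtain ⟨v, hv0, hv⟩ := exists_mulVec_eq_zero_iff.2 hroot
  have hAv : A *ᵥ v = r • v := by
    rw [sub_mulVec, sub_eq_zero] at hv
    rw [← hv]
    ext i
    simp [mulVec_diagonal]
  have hpos : 0 < v ⬝ᵥ (Q *ᵥ v) := by simpa using hQ.dotProduct_mulVec_pos hv0
  have h1 : v ⬝ᵥ (Q *ᵥ v) = r * (r * (v ⬝ᵥ (Q *ᵥ v))) := by
    conv_lhs => rw [← hA, ← mulVec_mulVec, ← mulVec_mulVec, hAv,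
      dotProduct_mulVec, vecMul_transpose, hAv, mulVec_smul, smul_dotProduct, dotProduct_smul,
      smul_eq_mul, smul_eq_mul]
  nlinarith [mul_pos hpos (sub_pos.2 hr), mul_pos (mul_pos hpos (sub_pos.2 hr)) (sub_pos.2 hr)]

/-- The ring homomorphism `B ↦ S B S⁻¹` from the matrices over a subfield of `ℝ` to the
real matrices. -/
noncomputable def conjMapMatrix (F : IntermediateField ℚ ℝ) (S : GL m ℝ) :
    Matrix m m F →+* Matrix m m ℝ where
  toFun B := S.val * B.map (algebraMap F ℝ) * S⁻¹.val
  map_one' := by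
    rw [Matrix.map_one _ (map_zero _) (map_one _), mul_one]
    exact S.mul_inv
  map_mul' A B := by
    have h : S⁻¹.val * S.val = 1 := S.inv_mul
    rw [Matrix.map_mul]
    simp only [mul_assoc]
    rw [← mul_assoc S⁻¹.val S.val, h, one_mul]
  map_zero' := by
    rw [Matrix.map_zero _ (map_zero _), mul_zero, zero_mul]
  map_add' A B := by
    rw [Matrix.map_add _ (map_add _), mul_add, add_mul]

theorem trace_conjMapMatrix (F : IntermediateField ℚ ℝ) (S : GL m ℝ) (B : Matrix m m F) :
    (conjMapMatrix F S B).trace = algebraMap F ℝ B.trace := by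
  have h : S⁻¹.val * S.val = 1 := S.inv_mul
  change (S.val * B.map (algebraMap F ℝ) * S⁻¹.val).trace = _
  rw [trace_mul_comm, ← mul_assoc, h, one_mul, AddMonoidHom.map_trace]

theorem charpoly_conjMapMatrix (F : IntermediateField ℚ ℝ) (S : GL m ℝ) (B : Matrix m m F) :
    (conjMapMatrix F S B).charpoly = B.charpoly.map (algebraMap F ℝ) := by
  rw [← charpoly_map]
  change (S.val * B.map (algebraMap F ℝ) * S⁻¹.val).charpoly = _
  rw [coe_units_inv]
  exact charpoly_units_conj S (B.map (algebraMap F ℝ))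

end FieldOfDefinition

/-! ### The Vinberg field, the field of definition and the Coxeter field -/

theorem mainTheorem4 (n N : ℕ) (hn : 2 ≤ n) (P : CoxeterPolyhedron n N)
    (hcof : P.IsCofinite) (hqa : IsQuasiArithmetic P.coxeterGroup)
    (π : Equiv.Perm (Fin N)) :
    P.vinbergField = coxeterField (P.coxeterTransformation π) := by
  refine le_antisymm ?_ (P.coxeterField_le_vinbergField π)
  obtain ⟨F, Q, S, _, _, -, -, hpos, -, hΓ⟩ := hqa
  have hdef : ∀ γ ∈ P.coxeterGroup, ∃ A : Matrix (Fin (n + 1)) (Fin (n + 1)) F,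
      A.transpose * Q * A = Q ∧ conjMapMatrix F S A = γ.val := by
    intro γ hγ
    obtain ⟨⟨hpres, -⟩, A, hA⟩ := hΓ γ hγ
    have hA' : A.val.map (algebraMap F ℝ) = (S⁻¹ * γ * S).val := congrArg Units.val hA
    refine ⟨A.val, ?_, ?_⟩
    · apply Matrix.map_injective (algebraMap F ℝ).injective
      change (A.val.transpose * Q * A.val).map (algebraMap F ℝ) = Q.map (algebraMap F ℝ)
      rw [Matrix.map_mul, Matrix.map_mul, Matrix.transpose_map, hA']
      exact hpres
    · change S.val * A.val.map (algebraMap F ℝ) * S⁻¹.val = γ.val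
      rw [hA', ← Units.val_mul, ← Units.val_mul]
      congr 1
      group
  have hK : P.vinbergField ≤ F := by
    refine IntermediateField.adjoin_le_iff.2 ?_
    rintro _ ⟨l, i, rfl⟩
    rw [← P.trace_prod_one_sub_reflectionMatrix i]
    have hmem : (List.ofFn fun k => 1 - reflectionMatrix (P.normal (i k))).prod ∈
        (conjMapMatrix F S).range := by
      refine list_prod_mem fun M hM => ?_
      obtain ⟨k, rfl⟩ := (List.mem_ofFn' _ _).1 hM
      obtain ⟨A, -, hA⟩ := hdef (P.reflection (i k)) (Subgroup.subset_closure ⟨_, rfl⟩)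
      exact sub_mem (one_mem _) ⟨A, hA⟩
    obtain ⟨B, hB⟩ := hmem
    rw [← hB, trace_conjMapMatrix]
    exact B.trace.2
  refine hK.trans (le_of_forall_embedding_eq F _ fun σ hσ => ?_)
  by_contra hne
  obtain ⟨c, hc⟩ := P.exists_dotProduct_gram_neg hn hcof
  obtain ⟨r, hr, hroot⟩ := P.exists_one_lt_isRoot_charpoly π hc
  obtain ⟨A, hAQ, hA⟩ := hdef _ (P.coxeterTransformation_mem π)
  have hchar : (P.coxeterTransformation π).val.charpoly = A.charpoly.map (algebraMap F ℝ) := by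
    rw [← hA, charpoly_conjMapMatrix]
  -- The coefficients of `A.charpoly` lie in the Coxeter field, where `σ` is the identity; so the
  -- root `r > 1` is also an eigenvalue of `A.map σ`, which preserves the positive definite `Q.map
  -- σ`.
  have hfix : A.charpoly.map (algebraMap F ℝ) = (A.map σ).charpoly := by
    rw [Matrix.charpoly_map]
    ext j
    rw [Polynomial.coeff_map, Polynomial.coeff_map]
    refine (hσ _ (IntermediateField.subset_adjoin ℚ _ ⟨j, ?_⟩)).symm
    simp only [hchar, Polynomial.coeff_map]
    rfl
  rw [hchar, hfix] at hroot
  refine not_isRoot_charpoly_of_posDef (hpos σ hne) ?_ hr hroot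
  have := congrArg (fun M => M.map σ) hAQ
  simpa only [Matrix.map_mul, ← Matrix.transpose_map] using this
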